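/- All graphs are finite, simple and undirected. A biclique of a graph $H$ is a maximal induced complete bipartite subgraph of $H$ (both parts non-empty). The edge-biclique graph $KB_e(H)$ has one vertex for each biclique of $H$, two distinct bicliques being adjacent when they share an edge of $H$. $L(H)$ denotes the line graph of $H$. The burgeon graph $B(G)$ is obtained from $G$ by replacing each vertex $v$ by a clique $C_v$ on $d(v)$ vertices, one for each neighbour of $v$, and joining, for each edge $vw$ of $G$, the vertex of $C_v$ that corresponds to $w$ with the vertex of $C_w$ that corresponds to $v$. A graph $H$ diverges under $KB_e$ if $\lim_{k\to\infty}|V(KB_e^k(H))|=\infty$, where $KB_e^0(H)=H$ and $KB_e^{k}(H)=KB_e^{k-1}(KB_e(H))$ for $k\ge 1$; $L^k$ is defined likewise. Let $G$ be a connected graph (with at least one vertex). Then $B(G)$ diverges under $KB_e$ if and only if $G$ is not a cycle (on $k\ge 3$ vertices), a path (on $k\ge 1$ vertices) or $K_{1,3}$. Moreover, for every $n\ge 0$, the graphs $KB_e^n(B(G))$ and $B(L^n(G))$ are isomorphic, unless $n\ge 1$ and $G$ is the path on exactly $n+1$ vertices. -/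

import Mathlib

open Filter

universe u

/-- A finite (undirected, simple) graph, bundled with its vertex type, so that graph operators
can be iterated. -/
structure FinGraph : Type (u + 1) where
  V : Type u
  finite : Finite V
  graph : SimpleGraph V

namespace FinGraph

attribute [instance] FinGraph.finite

/-- Isomorphism of graphs (equality of graphs up to the names of the vertices). -/
def Iso (G H : FinGraph.{u}) : Prop := Nonempty (G.graph ≃g H.graph)

/-- `G` is a path, on any number `k ≥ 1` of vertices. -/
def IsPath (G : FinGraph.{u}) : Prop :=
  ∃ k : ℕ, 1 ≤ k ∧ Nonempty (G.graph ≃g SimpleGraph.pathGraph k)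

/-- `G` is a cycle, on `k ≥ 3` vertices. -/
def IsCycle (G : FinGraph.{u}) : Prop :=
  ∃ k : ℕ, 3 ≤ k ∧ Nonempty (G.graph ≃g SimpleGraph.cycleGraph k)

/-- `G` is the complete bipartite graph `K_{1,3}`. -/
def IsClaw (G : FinGraph.{u}) : Prop :=
  Nonempty (G.graph ≃g completeBipartiteGraph (Fin 1) (Fin 3))

/-- `G` diverges under the operator `H`: `|V(H^k(G))| → ∞`. -/
def Diverges (H : FinGraph.{u} → FinGraph.{u}) (G : FinGraph.{u}) : Prop :=
  Tendsto (fun k : ℕ => Nat.card (H^[k] G).V) atTop atTop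

/-- The subgraph of `G` induced by `S` is complete bipartite (with two non-empty parts). -/
def InducesCompleteBipartite {V : Type u} (G : SimpleGraph V) (S : Set V) : Prop :=
  ∃ U W : Set V, U.Nonempty ∧ W.Nonempty ∧ Disjoint U W ∧ U ∪ W = S ∧
    G.IsIndepSet U ∧ G.IsIndepSet W ∧ ∀ u ∈ U, ∀ w ∈ W, G.Adj u w

/-- `S` is the vertex set of a biclique: a maximal induced complete bipartite subgraph. An induced
subgraph is determined by its vertex set. -/
def IsBiclique {V : Type u} (G : SimpleGraph V) (S : Set V) : Prop :=
  Maximal (InducesCompleteBipartite G) S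

/-- The edge-biclique graph: the vertices are the bicliques of `G`, and two distinct bicliques are
adjacent when they have a common edge. -/
def edgeBicliqueGraph (G : FinGraph.{u}) : FinGraph.{u} where
  V := {S : Set G.V // IsBiclique G.graph S}
  finite := inferInstance
  graph :=
    { Adj := fun S T => S ≠ T ∧
        ∃ x y : G.V, G.graph.Adj x y ∧ (x ∈ S.1 ∧ y ∈ S.1) ∧ (x ∈ T.1 ∧ y ∈ T.1)
      symm := ⟨fun _ _ ⟨h, x, y, hxy, hS, hT⟩ => ⟨h.symm, x, y, hxy, hT, hS⟩⟩
      loopless := ⟨fun _ h => h.1 rfl⟩ }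

/-- The line graph. -/
def lineGraph (G : FinGraph.{u}) : FinGraph.{u} where
  V := G.graph.edgeSet
  finite := inferInstance
  graph := G.graph.lineGraph

/-- The burgeon graph: the vertices are the darts (ordered pairs `(v, w)` of adjacent vertices).
The darts starting at `v` form the clique `C_v`, which has `d(v)` vertices; the only neighbour of
`(v, w)` outside `C_v` is `(w, v)`, which lies in `C_w`. -/
def burgeon (G : FinGraph.{u}) : FinGraph.{u} where
  V := G.graph.Dart
  finite := Finite.of_injective _ SimpleGraph.Dart.toProd_injective
  graph :=
    { Adj := fun d e => d ≠ e ∧ (d.fst = e.fst ∨ e = d.symm)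
      symm := ⟨by
        rintro d e ⟨h, h' | h'⟩
        · exact ⟨h.symm, Or.inl h'.symm⟩
        · exact ⟨h.symm, Or.inr (by rw [h', SimpleGraph.Dart.symm_symm])⟩⟩
      loopless := ⟨fun _ h => h.1 rfl⟩ }

end FinGraph

/-! The burgeon graph is a disjoint union of cliques `C_v` plus a matching. If no component of `G`
is a single edge, its bicliques are the induced paths `(v,u), (v,w), (w,v)` with `u ≠ w`, that is,
the angles `(u,v,w)` of `G`. The map `(u,v,w) ↦ (vw, vu)` is a bijection from angles to darts of
`L(G)`, and two bicliques share an edge exactly when the corresponding darts are adjacent in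
`B(L(G))`. Hence `KB_e(B(G)) ≅ B(L(G))` (`edgeBicliqueGraph_burgeon_iso`), which iterates as long as
no isolated edge appears. For connected `G` one appears only when some `L^i(G)` is the path on two
vertices, so only when `G` is a path; that is the source of the exception.

Since `B(H)` has `2|E(H)|` vertices, divergence outside the path case is a question about the orders
`x n` of `L^n(G)`. Line graphs of 2-regular graphs are 2-regular of the same order, and the line
graph of the claw is a triangle. Every other connected graph that is not a path has a vertex of
degree at least 3, and so do all its iterated line graphs. Then `∑ (d(v)-1)(d(v)-2) > 0` makes `x`
strictly convex; connectedness gives `x 1 - x 0 ≥ -1`, so `x` is eventually strictly increasing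
(`tendsto_card_iterate_lineGraph`). For paths both sequences of graphs become empty. -/

namespace FinGraph

open SimpleGraph

/-! ### Angles and the bicliques of the burgeon graph -/

/-- An angle of a graph: an ordered pair `(u, w)` of distinct neighbours of a vertex `v`. -/
@[ext]
structure Angle {V : Type u} (G : SimpleGraph V) where
  u : V
  v : V
  w : V
  adj_left : G.Adj v u
  adj_right : G.Adj v w
  ne : u ≠ w

/-- The graph on the darts of `G` that underlies the burgeon graph. -/
def dartGraph {V : Type u} (G : SimpleGraph V) : SimpleGraph G.Dart where
  Adj d e := d ≠ e ∧ (d.fst = e.fst ∨ e = d.symm)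
  symm := ⟨by
    rintro d e ⟨h, h' | h'⟩
    · exact ⟨h.symm, Or.inl h'.symm⟩
    · exact ⟨h.symm, Or.inr (by rw [h', Dart.symm_symm])⟩⟩
  loopless := ⟨fun _ h => h.1 rfl⟩

lemma dartGraph_adj_iff {V : Type u} {G : SimpleGraph V} (d e : G.Dart) :
    (dartGraph G).Adj d e ↔
      (d.fst = e.fst ∧ d.snd ≠ e.snd) ∨ (d.fst = e.snd ∧ d.snd = e.fst) := by
  obtain ⟨⟨a, b⟩, h⟩ := d
  obtain ⟨⟨c, d⟩, h'⟩ := e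
  have := h.ne
  have := h'.ne
  simp only [dartGraph, Dart.ext_iff, Dart.symm, Prod.swap, Prod.mk.injEq, ne_eq] at *
  grind

/-- The graph on the bicliques of `G` that underlies the edge-biclique graph. -/
def bicliqueGraph {V : Type u} (G : SimpleGraph V) : SimpleGraph {S : Set V // IsBiclique G S} where
  Adj S T := S ≠ T ∧ ∃ x y : V, G.Adj x y ∧ (x ∈ S.1 ∧ y ∈ S.1) ∧ (x ∈ T.1 ∧ y ∈ T.1)
  symm := ⟨fun _ _ ⟨h, x, y, hxy, hS, hT⟩ => ⟨h.symm, x, y, hxy, hT, hS⟩⟩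
  loopless := ⟨fun _ h => h.1 rfl⟩

/-- The three darts of an angle: they induce a path in the burgeon graph, and `(v, w)` is the
middle vertex of that path. -/
def Angle.darts {V : Type u} {G : SimpleGraph V} (t : Angle G) : Set G.Dart :=
  {d | (d.fst = t.v ∧ d.snd = t.u) ∨ (d.fst = t.v ∧ d.snd = t.w) ∨ (d.fst = t.w ∧ d.snd = t.v)}

lemma Angle.mem_darts {V : Type u} {G : SimpleGraph V} (t : Angle G) (d : G.Dart) :
    d ∈ t.darts ↔ (d.fst = t.v ∧ d.snd = t.u) ∨ (d.fst = t.v ∧ d.snd = t.w) ∨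
      (d.fst = t.w ∧ d.snd = t.v) := Iff.rfl

lemma Angle.inducesCompleteBipartite_darts {V : Type u} {G : SimpleGraph V} (t : Angle G) :
    InducesCompleteBipartite (dartGraph G) t.darts := by
  have h1 := t.adj_left.ne
  have h2 := t.adj_right.ne
  have h3 := t.ne
  refine ⟨{d : G.Dart | d.fst = t.v ∧ d.snd = t.w},
    {d : G.Dart | (d.fst = t.v ∧ d.snd = t.u) ∨ (d.fst = t.w ∧ d.snd = t.v)},
    ⟨⟨(t.v, t.w), t.adj_right⟩, by simp⟩, ⟨⟨(t.v, t.u), t.adj_left⟩, by simp⟩, ?_, ?_, ?_, ?_, ?_⟩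
  · rw [Set.disjoint_left]
    rintro (d : G.Dart) hd hd'
    simp only [Set.mem_ofPred_eq] at hd hd'
    grind
  · ext (d : G.Dart)
    simp only [Set.mem_union, Set.mem_ofPred_eq, Angle.mem_darts]
    grind
  · rintro (d : G.Dart) hd (e : G.Dart) he - hde
    rw [dartGraph_adj_iff] at hde
    simp only [Set.mem_ofPred_eq] at hd he
    grind
  · rintro (d : G.Dart) hd (e : G.Dart) he - hde
    rw [dartGraph_adj_iff] at hde
    simp only [Set.mem_ofPred_eq] at hd he
    grind
  · rintro (d : G.Dart) hd (e : G.Dart) he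
    rw [dartGraph_adj_iff]
    simp only [Set.mem_ofPred_eq] at hd he
    grind

/-- The only mutually reverse darts of an angle are `(v,w)` and `(w,v)`, and the third dart starts
at `v`. Inclusion suffices, which yields maximality of the bicliques as well as injectivity. -/
lemma Angle.eq_of_darts_subset {V : Type u} {G : SimpleGraph V} {s t : Angle G}
    (h : s.darts ⊆ t.darts) : s = t := by
  have h1 := h (a := ⟨(s.v, s.u), s.adj_left⟩) (by simp [Angle.mem_darts])
  have h2 := h (a := ⟨(s.v, s.w), s.adj_right⟩) (by simp [Angle.mem_darts])
  have h3 := h (a := ⟨(s.w, s.v), s.adj_right.symm⟩) (by simp [Angle.mem_darts])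
  simp only [Angle.mem_darts] at h1 h2 h3
  have := s.adj_left.ne
  have := s.adj_right.ne
  have := s.ne
  have := t.adj_left.ne
  have := t.adj_right.ne
  have := t.ne
  ext <;> grind

/-- No edge of `G` is a connected component: every edge meets another edge. -/
def NoIsolatedEdge {V : Type u} (G : SimpleGraph V) : Prop :=
  ∀ u v, G.Adj u v → (∃ w, w ≠ v ∧ G.Adj u w) ∨ ∃ w, w ≠ u ∧ G.Adj v w

/-- The case where some edge between the parts lies inside a clique `C_v`. A neighbour of `b` is its
reverse or lies in `C_v`, where it would be adjacent to `a`; so `U ⊆ {a, b.symm}`, and symmetrically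
`W ⊆ {b, a.symm}`. -/
lemma exists_angle_of_parts {V : Type u} {G : SimpleGraph V} {U W : Set G.Dart}
    (hU : (dartGraph G).IsIndepSet U) (hW : (dartGraph G).IsIndepSet W)
    (hUW : ∀ u ∈ U, ∀ w ∈ W, (dartGraph G).Adj u w) {a b : G.Dart}
    (ha : a ∈ U) (hb : b ∈ W) (hfst : a.fst = b.fst) :
    ∃ t : Angle G, U ∪ W ⊆ t.darts := by
  have hab := hUW a ha b hb
  rw [dartGraph_adj_iff] at hab
  have ha' := a.adj.ne
  have hb' := b.adj.ne
  have key1 : ∀ x ∈ U, x = a ∨ (x.fst = b.snd ∧ x.snd = b.fst) := by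
    intro x hx
    have h1 := hUW x hx b hb
    have h2 : x ≠ a → ¬(dartGraph G).Adj x a := hU hx ha
    rw [dartGraph_adj_iff] at h1 h2
    rw [Dart.ext_iff, Prod.ext_iff]
    rw [ne_eq, Dart.ext_iff, Prod.ext_iff] at h2
    grind
  have key2 : ∀ x ∈ W, x = b ∨ (x.fst = a.snd ∧ x.snd = a.fst) := by
    intro x hx
    have h1 := hUW a ha x hx
    have h2 : x ≠ b → ¬(dartGraph G).Adj x b := hW hx hb
    rw [dartGraph_adj_iff] at h1 h2
    rw [Dart.ext_iff, Prod.ext_iff]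
    rw [ne_eq, Dart.ext_iff, Prod.ext_iff] at h2
    grind
  -- The reverses of `a` and `b` cannot both occur, as they are not adjacent. If `b.symm` occurs,
  -- `b` is the middle of the path; otherwise `a` is.
  by_cases hx : ∃ x ∈ U, x.fst = b.snd ∧ x.snd = b.fst
  · obtain ⟨x, hx, hx1, hx2⟩ := hx
    refine ⟨⟨a.snd, a.fst, b.snd, a.adj, hfst ▸ b.adj, by grind⟩, ?_⟩
    rintro y (hy | hy)
    · rcases key1 y hy with rfl | h <;> simp [Angle.mem_darts] <;> grind
    · rcases key2 y hy with rfl | h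
      · simp [Angle.mem_darts]; grind
      · have h1 := hUW x hx y hy
        rw [dartGraph_adj_iff] at h1
        grind
  · push Not at hx
    refine ⟨⟨b.snd, a.fst, a.snd, hfst ▸ b.adj, a.adj, by grind⟩, ?_⟩
    rintro y (hy | hy)
    · rcases key1 y hy with rfl | h
      · simp [Angle.mem_darts]
      · grind
    · rcases key2 y hy with rfl | h <;> simp [Angle.mem_darts] <;> grind

lemma exists_angle_of_inducesCompleteBipartite {V : Type u} {G : SimpleGraph V} (hG : NoIsolatedEdge G)
    {S : Set G.Dart} (hS : InducesCompleteBipartite (dartGraph G) S) :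
    ∃ t : Angle G, S ⊆ t.darts := by
  obtain ⟨U, W, ⟨a, ha⟩, ⟨b, hb⟩, -, rfl, hU, hW, hUW⟩ := hS
  by_cases h : ∃ a' ∈ U, ∃ b' ∈ W, a'.fst = b'.fst
  · obtain ⟨a', ha', b', hb', hfst⟩ := h
    exact exists_angle_of_parts hU hW hUW ha' hb' hfst
  · push Not at h
    -- All edges between the parts are now matching edges, so the set is a dart with its reverse;
    -- `hG` supplies an adjacent edge of `G` that completes it to an angle.
    have key : ∀ x ∈ U, ∀ y ∈ W, x.fst = y.snd ∧ x.snd = y.fst := by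
      intro x hx y hy
      have h1 := hUW x hx y hy
      rw [dartGraph_adj_iff] at h1
      grind
    have hab := key a ha b hb
    rcases hG a.fst a.snd a.adj with ⟨w, hw, hadj⟩ | ⟨w, hw, hadj⟩
    · refine ⟨⟨w, a.fst, a.snd, hadj, a.adj, hw⟩, ?_⟩
      rintro y (hy | hy)
      · have := key y hy b hb
        simp only [Angle.mem_darts]; grind
      · have := key a ha y hy
        simp only [Angle.mem_darts]; grind
    · refine ⟨⟨w, a.snd, a.fst, hadj, a.adj.symm, hw⟩, ?_⟩
      rintro y (hy | hy)
      · have := key y hy b hb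
        simp only [Angle.mem_darts]; grind
      · have := key a ha y hy
        simp only [Angle.mem_darts]; grind

lemma Angle.isBiclique_darts {V : Type u} {G : SimpleGraph V} (hG : NoIsolatedEdge G)
    (t : Angle G) : IsBiclique (dartGraph G) t.darts := by
  refine ⟨t.inducesCompleteBipartite_darts, fun S hS hle => ?_⟩
  obtain ⟨s, hs⟩ := exists_angle_of_inducesCompleteBipartite hG hS
  obtain rfl := Angle.eq_of_darts_subset (hle.trans hs)
  exact hs

/-- The bicliques of the burgeon graph are the angles. -/
noncomputable def angleEquivBiclique {V : Type u} {G : SimpleGraph V} (hG : NoIsolatedEdge G) :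
    Angle G ≃ {S : Set G.Dart // IsBiclique (dartGraph G) S} :=
  Equiv.ofBijective (fun t => ⟨t.darts, t.isBiclique_darts hG⟩) <| by
    refine ⟨fun s t h => Angle.eq_of_darts_subset (Subtype.ext_iff.1 h).le, ?_⟩
    rintro ⟨S, hS⟩
    obtain ⟨t, ht⟩ := exists_angle_of_inducesCompleteBipartite hG hS.prop
    exact ⟨t, Subtype.ext (hS.eq_of_subset t.inducesCompleteBipartite_darts ht).symm⟩

/-! ### Angles as darts of the line graph, and the isomorphism `KB_e(B(G)) ≅ B(L(G))` -/

lemma lineGraph_adj_iff {V : Type u} {G : SimpleGraph V} (e f : G.edgeSet) :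
    G.lineGraph.Adj e f ↔ e ≠ f ∧ ∃ v, v ∈ e.1 ∧ v ∈ f.1 := Iff.rfl

/-- The angle `(u, v, w)`, as the ordered pair of edges `(vw, vu)`. -/
def Angle.toDart {V : Type u} {G : SimpleGraph V} (t : Angle G) : G.lineGraph.Dart :=
  ⟨(⟨s(t.v, t.w), t.adj_right⟩, ⟨s(t.v, t.u), t.adj_left⟩), by
    refine (lineGraph_adj_iff _ _).2 ⟨?_, t.v, by simp, by simp⟩
    have := t.ne
    have := t.adj_left.ne
    simp only [ne_eq]
    grind⟩

lemma Angle.toDart_bijective {V : Type u} (G : SimpleGraph V) :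
    Function.Bijective (Angle.toDart : Angle G → G.lineGraph.Dart) := by
  constructor
  · intro s t h
    rw [Dart.ext_iff, Prod.ext_iff] at h
    simp only [Angle.toDart] at h
    have := s.adj_left.ne
    have := s.adj_right.ne
    have := s.ne
    have := t.ne
    ext <;> grind
  · rintro ⟨⟨⟨e, he⟩, ⟨f, hf⟩⟩, h⟩
    obtain ⟨hne, v, hv, hv'⟩ := (lineGraph_adj_iff _ _).1 h
    obtain ⟨w, rfl⟩ := Sym2.mem_iff_exists.1 hv
    obtain ⟨x, rfl⟩ := Sym2.mem_iff_exists.1 hv'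
    exact ⟨⟨x, v, w, hf, he, by rintro rfl; exact hne rfl⟩, rfl⟩

/-- The darts of the line graph are the angles. -/
noncomputable def angleEquivDart {V : Type u} (G : SimpleGraph V) :
    Angle G ≃ G.lineGraph.Dart :=
  Equiv.ofBijective _ (Angle.toDart_bijective G)

/-- The shared edge is either the matching edge on `{v,w}`, in one of two orientations, or the edge
inside `C_v` joining `(v,u)` and `(v,w)`. The right-hand side is the same as in
`dartGraph_lineGraph_adj_iff`. -/
lemma bicliqueGraph_adj_iff {V : Type u} {G : SimpleGraph V} (hG : NoIsolatedEdge G)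
    (s t : Angle G) :
    (bicliqueGraph (dartGraph G)).Adj (angleEquivBiclique hG s) (angleEquivBiclique hG t) ↔
      s ≠ t ∧ ((s.v = t.v ∧ s.w = t.w) ∨ (s.v = t.w ∧ s.w = t.v) ∨
        (s.v = t.v ∧ s.u = t.w ∧ s.w = t.u)) := by
  have h1 := s.adj_left.ne
  have h2 := s.adj_right.ne
  have h3 := s.ne
  have h4 := t.adj_left.ne
  have h5 := t.adj_right.ne
  have h6 := t.ne
  change (angleEquivBiclique hG s ≠ angleEquivBiclique hG t ∧ ∃ x y : G.Dart,
    (dartGraph G).Adj x y ∧ (x ∈ s.darts ∧ y ∈ s.darts) ∧ (x ∈ t.darts ∧ y ∈ t.darts)) ↔ _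
  rw [(angleEquivBiclique hG).injective.ne_iff]
  refine and_congr_right fun hne => ⟨?_, ?_⟩
  · rintro ⟨x, y, hxy, ⟨hx, hy⟩, hx', hy'⟩
    rw [dartGraph_adj_iff] at hxy
    rw [Angle.mem_darts] at hx hy hx' hy'
    have := x.adj.ne
    have := y.adj.ne
    grind
  · rintro (⟨h, h'⟩ | ⟨h, h'⟩ | ⟨h, h', h''⟩)
    · refine ⟨⟨(s.v, s.w), s.adj_right⟩, ⟨(s.w, s.v), s.adj_right.symm⟩, ?_⟩
      simp [dartGraph_adj_iff, Angle.mem_darts, h, h']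
    · refine ⟨⟨(s.v, s.w), s.adj_right⟩, ⟨(s.w, s.v), s.adj_right.symm⟩, ?_⟩
      simp [dartGraph_adj_iff, Angle.mem_darts, h, h']
    · refine ⟨⟨(s.v, s.w), s.adj_right⟩, ⟨(s.v, s.u), s.adj_left⟩, ?_⟩
      simp [dartGraph_adj_iff, Angle.mem_darts, h, h', h'', h6]

/-- Equal first edges `vw` give the first two alternatives; a reversed dart swaps `vw` and `vu`,
which fixes their common vertex `v` and gives the third. -/
lemma dartGraph_lineGraph_adj_iff {V : Type u} {G : SimpleGraph V} (s t : Angle G) :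
    (dartGraph G.lineGraph).Adj (angleEquivDart G s) (angleEquivDart G t) ↔
      s ≠ t ∧ ((s.v = t.v ∧ s.w = t.w) ∨ (s.v = t.w ∧ s.w = t.v) ∨
        (s.v = t.v ∧ s.u = t.w ∧ s.w = t.u)) := by
  have h1 := s.adj_left.ne
  have h2 := s.adj_right.ne
  have h3 := s.ne
  have h4 := t.adj_left.ne
  have h5 := t.adj_right.ne
  have h6 := t.ne
  change (angleEquivDart G s ≠ angleEquivDart G t ∧
    (s.toDart.fst = t.toDart.fst ∨ t.toDart = s.toDart.symm)) ↔ _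
  rw [(angleEquivDart G).injective.ne_iff]
  refine and_congr_right fun hne => ?_
  rw [Dart.ext_iff, Prod.ext_iff]
  simp only [Angle.toDart, Dart.symm_toProd, Prod.fst_swap, Prod.snd_swap]
  grind

/-- The bicliques of the burgeon graph and the darts of the line graph form isomorphic graphs. -/
noncomputable def bicliqueGraphDartGraphIso {V : Type u} {G : SimpleGraph V}
    (hG : NoIsolatedEdge G) : bicliqueGraph (dartGraph G) ≃g dartGraph G.lineGraph :=
  ⟨(angleEquivBiclique hG).symm.trans (angleEquivDart G), by
    intro a b
    obtain ⟨s, rfl⟩ := (angleEquivBiclique hG).surjective a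
    obtain ⟨t, rfl⟩ := (angleEquivBiclique hG).surjective b
    simp only [Equiv.trans_apply, Equiv.symm_apply_apply]
    rw [bicliqueGraph_adj_iff, dartGraph_lineGraph_adj_iff]⟩

/-- The edge-biclique graph of the burgeon graph of `G` is the burgeon graph of the line graph. -/
theorem edgeBicliqueGraph_burgeon_iso (G : FinGraph.{u}) (hG : NoIsolatedEdge G.graph) :
    Iso (edgeBicliqueGraph G.burgeon) G.lineGraph.burgeon :=
  -- The bundled graphs unfold to `bicliqueGraph` and `dartGraph`.
  ⟨bicliqueGraphDartGraphIso hG⟩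

/-! ### Invariance of the edge-biclique graph under isomorphism -/

lemma Iso.refl (G : FinGraph.{u}) : Iso G G := ⟨RelIso.refl _⟩

lemma Iso.trans {G H K : FinGraph.{u}} (h : Iso G H) (h' : Iso H K) : Iso G K :=
  ⟨h.some.trans h'.some⟩

lemma inducesCompleteBipartite_image {V W : Type u} {G : SimpleGraph V} {H : SimpleGraph W}
    (f : G ≃g H) {S : Set V} (hS : InducesCompleteBipartite G S) :
    InducesCompleteBipartite H (f '' S) := by
  obtain ⟨A, B, hA, hB, hAB, rfl, hA', hB', hadj⟩ := hS
  refine ⟨f '' A, f '' B, hA.image _, hB.image _, (Set.disjoint_image_iff f.injective).2 hAB,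
    (Set.image_union _ _ _).symm, ?_, ?_, ?_⟩
  · rintro _ ⟨a, ha, rfl⟩ _ ⟨b, hb, rfl⟩ hne
    rw [f.map_adj_iff]
    exact hA' ha hb fun h => hne (h ▸ rfl)
  · rintro _ ⟨a, ha, rfl⟩ _ ⟨b, hb, rfl⟩ hne
    rw [f.map_adj_iff]
    exact hB' ha hb fun h => hne (h ▸ rfl)
  · rintro _ ⟨a, ha, rfl⟩ _ ⟨b, hb, rfl⟩
    rw [f.map_adj_iff]
    exact hadj a ha b hb

lemma isBiclique_image {V W : Type u} {G : SimpleGraph V} {H : SimpleGraph W}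
    (f : G ≃g H) {S : Set V} (hS : IsBiclique G S) : IsBiclique H (f '' S) := by
  refine ⟨inducesCompleteBipartite_image f hS.prop, fun T hT hle => ?_⟩
  have h1 := hS.le_of_ge (inducesCompleteBipartite_image f.symm hT) (fun x hx =>
    ⟨f x, hle ⟨x, hx, rfl⟩, f.symm_apply_apply x⟩)
  intro y hy
  exact ⟨f.symm y, h1 ⟨y, hy, rfl⟩, f.apply_symm_apply y⟩

/-- Isomorphic graphs have isomorphic edge-biclique graphs. -/
def bicliqueGraphIso {V W : Type u} {G : SimpleGraph V} {H : SimpleGraph W} (f : G ≃g H) :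
    bicliqueGraph G ≃g bicliqueGraph H where
  toFun S := ⟨f '' S.1, isBiclique_image f S.2⟩
  invFun S := ⟨f.symm '' S.1, isBiclique_image f.symm S.2⟩
  left_inv S := Subtype.ext (by simp [Set.image_image])
  right_inv S := Subtype.ext (by simp [Set.image_image])
  map_rel_iff' := by
    have hinj := f.injective
    rintro ⟨S, hS⟩ ⟨T, hT⟩
    refine and_congr (not_congr ?_) ⟨?_, ?_⟩
    · simp only [Equiv.coe_fn_mk, Subtype.mk.injEq, hinj.image_injective.eq_iff]
    · rintro ⟨_, _, hxy, ⟨⟨x, hx, rfl⟩, ⟨y, hy, rfl⟩⟩, ⟨x', hx', hxx⟩, ⟨y', hy', hyy⟩⟩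
      obtain rfl := hinj hxx
      obtain rfl := hinj hyy
      exact ⟨_, _, f.map_adj_iff.1 hxy, ⟨hx, hy⟩, hx', hy'⟩
    · rintro ⟨x, y, hxy, ⟨hx, hy⟩, hx', hy'⟩
      exact ⟨f x, f y, f.map_adj_iff.2 hxy, ⟨⟨x, hx, rfl⟩, ⟨y, hy, rfl⟩⟩, ⟨x, hx', rfl⟩,
        ⟨y, hy', rfl⟩⟩

lemma Iso.edgeBicliqueGraph {G H : FinGraph.{u}} (h : Iso G H) :
    Iso (edgeBicliqueGraph G) (edgeBicliqueGraph H) :=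
  ⟨bicliqueGraphIso h.some⟩

/-! ### Line graphs of 2-regular graphs, paths, the claw and graphs with a fork -/

section LineGraph

variable {V W : Type*} {G : SimpleGraph V} {H : SimpleGraph W}

/-- Consecutive edges of a walk meet. Only preconnectedness survives: the edge set may be empty. -/
lemma lineGraph_preconnected (hG : G.Preconnected) : G.lineGraph.Preconnected := by
  have hmeet : ∀ (e f : G.edgeSet) (a : V), a ∈ e.1 → a ∈ f.1 → G.lineGraph.Reachable e f := by
    intro e f a he hf
    by_cases h : e = f
    · exact h ▸ Reachable.refl _
    · exact Adj.reachable ⟨h, a, he, hf⟩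
  have hwalk : ∀ (a c : V) (_ : G.Walk a c) (e f : G.edgeSet), a ∈ e.1 → c ∈ f.1 →
      G.lineGraph.Reachable e f := by
    intro a c p
    induction p with
    | nil => exact fun e f he hf => hmeet e f _ he hf
    | cons h p ih =>
      exact fun e f he hf => (hmeet e ⟨_, h⟩ _ he (Sym2.mem_mk_left _ _)).trans
        (ih ⟨_, h⟩ f (Sym2.mem_mk_right _ _) hf)
  rintro ⟨⟨a, b⟩, he⟩ ⟨⟨c, d⟩, hf⟩
  obtain ⟨p⟩ := hG a c
  exact hwalk a c p _ _ (Sym2.mem_mk_left _ _) (Sym2.mem_mk_left _ _)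

/-- Some vertex of `G` has at least three neighbours. -/
def HasFork {V : Type*} (G : SimpleGraph V) : Prop :=
  ∃ v a b c, G.Adj v a ∧ G.Adj v b ∧ G.Adj v c ∧ a ≠ b ∧ a ≠ c ∧ b ≠ c

/-- Every vertex of `G` has exactly two neighbours. -/
def TwoRegular {V : Type*} (G : SimpleGraph V) : Prop :=
  ∀ v, ∃ a b, a ≠ b ∧ ∀ x, G.Adj v x ↔ x = a ∨ x = b

lemma TwoRegular.of_iso (f : G ≃g H) (hG : TwoRegular G) : TwoRegular H := by
  intro v
  obtain ⟨a, b, hab, h⟩ := hG (f.symm v)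
  refine ⟨f a, f b, f.injective.ne hab, fun x => ?_⟩
  rw [← f.symm.map_adj_iff, h, ← f.injective.eq_iff, ← f.injective.eq_iff (b := b),
    f.apply_symm_apply]

/-- The edge `uv`, as an element of the edge set. -/
def mkEdge {u v : V} (h : G.Adj u v) : G.edgeSet := ⟨s(u, v), h⟩

lemma mkEdge_inj {u v u' v' : V} (h : G.Adj u v) (h' : G.Adj u' v') :
    mkEdge h = mkEdge h' ↔ (u = u' ∧ v = v') ∨ (u = v' ∧ v = u') := by
  rw [Subtype.ext_iff]
  exact Sym2.eq_iff

lemma exists_eq_mkEdge (e : G.edgeSet) : ∃ u v, ∃ h : G.Adj u v, e = mkEdge h := by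
  obtain ⟨⟨u, v⟩, h⟩ := e
  exact ⟨u, v, h, rfl⟩

lemma lineGraph_adj_mkEdge {u v u' v' : V} (h : G.Adj u v) (h' : G.Adj u' v') :
    G.lineGraph.Adj (mkEdge h) (mkEdge h') ↔ mkEdge h ≠ mkEdge h' ∧
      (u = u' ∨ u = v' ∨ v = u' ∨ v = v') := by
  refine and_congr_right fun _ => ?_
  change (∃ x, x ∈ s(u, v) ∧ x ∈ s(u', v')) ↔ _
  simp [Sym2.mem_iff, or_and_right, exists_or]
  tauto

/-- The neighbours of the edge `uv` are the other edge at `u` and the other edge at `v`. -/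
lemma TwoRegular.lineGraph (hG : TwoRegular G) : TwoRegular G.lineGraph := by
  intro e
  obtain ⟨u, v, huv, rfl⟩ := exists_eq_mkEdge e
  have key : ∀ u v, G.Adj u v → ∃ u', u' ≠ v ∧ ∀ x, G.Adj u x ↔ x = v ∨ x = u' := by
    intro u v huv
    obtain ⟨a, b, hab, h⟩ := hG u
    rcases (h v).1 huv with rfl | rfl
    · exact ⟨b, hab.symm, h⟩
    · exact ⟨a, hab, fun x => (h x).trans or_comm⟩
  obtain ⟨u', hu', hu⟩ := key u v huv
  obtain ⟨v', hv', hv⟩ := key v u huv.symm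
  have hadju := (hu u').2 (Or.inr rfl)
  have hadjv := (hv v').2 (Or.inr rfl)
  have h1 := huv.ne
  refine ⟨mkEdge hadju, mkEdge hadjv, ?_, ?_⟩
  · rw [ne_eq, mkEdge_inj]
    grind
  · intro f
    obtain ⟨x, y, hxy, rfl⟩ := exists_eq_mkEdge f
    have := hu x
    have := hu y
    have := hv x
    have := hv y
    have := hxy.symm
    have := hxy.ne
    rw [lineGraph_adj_mkEdge, ne_eq, mkEdge_inj, mkEdge_inj, mkEdge_inj]
    grind

lemma twoRegular_cycleGraph {k : ℕ} (hk : 3 ≤ k) : TwoRegular (cycleGraph k) := by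
  obtain ⟨n, rfl⟩ := Nat.exists_eq_add_of_le' hk
  intro v
  refine ⟨v + 1, v - 1, ?_, fun x => ?_⟩
  · intro h
    -- The two neighbours differ because `2 ≠ 0` modulo `n + 3`.
    have h2 : (1 + 1 : Fin (n + 3)) = 0 := by
      rw [eq_sub_iff_add_eq, add_assoc] at h
      simpa using h
    exact absurd (congrArg Fin.val h2) (by
      simp [Fin.val_add, Nat.mod_eq_of_lt (show 2 < n + 3 by omega)])
  · rw [cycleGraph_adj (n := n + 1)]
    constructor
    · rintro (h | h)
      · right; rw [← h]; abel
      · left; rw [← h]; abel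
    · rintro (rfl | rfl)
      · right; abel
      · left; abel

lemma twoRegular_lineGraph_claw :
    TwoRegular (completeBipartiteGraph (Fin 1) (Fin 3)).lineGraph := by
  have hadj : ∀ i : Fin 3, (completeBipartiteGraph (Fin 1) (Fin 3)).Adj (Sum.inl 0) (Sum.inr i) := by
    simp
  have hedge : ∀ e : (completeBipartiteGraph (Fin 1) (Fin 3)).edgeSet,
      ∃ i, e = mkEdge (hadj i) := by
    intro e
    obtain ⟨x, y, h, rfl⟩ := exists_eq_mkEdge e
    simp only [mkEdge_inj]
    rcases x with x | x <;> rcases y with y | y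
    · simp at h
    · exact ⟨y, Or.inl ⟨by rw [Subsingleton.elim x 0], rfl⟩⟩
    · exact ⟨x, Or.inr ⟨rfl, by rw [Subsingleton.elim y 0]⟩⟩
    · simp at h
  have hinj : ∀ i j : Fin 3, mkEdge (hadj i) = mkEdge (hadj j) ↔ i = j := by
    intro i j
    rw [mkEdge_inj]
    simp
  intro e
  obtain ⟨i, rfl⟩ := hedge e
  refine ⟨mkEdge (hadj (i + 1)), mkEdge (hadj (i + 2)), ?_, ?_⟩
  · rw [ne_eq, hinj]
    revert i; decide
  · intro f
    obtain ⟨j, rfl⟩ := hedge f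
    rw [hinj, hinj, lineGraph_adj_mkEdge, ne_eq, hinj]
    simp only [true_or, and_true]
    revert i j; decide

/-- The line graph of a path is a path with one vertex less. -/
lemma nonempty_lineGraph_pathGraph_iso (k : ℕ) :
    Nonempty ((pathGraph k).lineGraph ≃g pathGraph (k - 1)) := by
  have hadj : ∀ i : Fin (k - 1), (pathGraph k).Adj ⟨i, by omega⟩ ⟨i + 1, by omega⟩ := by
    intro i; rw [pathGraph_adj]; simp
  let F : Fin (k - 1) → (pathGraph k).edgeSet := fun i => mkEdge (hadj i)
  have hinj : Function.Injective F := by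
    intro i j h
    rw [mkEdge_inj] at h
    simp only [Fin.mk.injEq] at h
    ext; omega
  have hsurj : Function.Surjective F := by
    intro e
    obtain ⟨x, y, h, rfl⟩ := exists_eq_mkEdge e
    have h' := h
    rw [pathGraph_adj] at h'
    rcases h' with h' | h'
    · exact ⟨⟨x, by omega⟩, (mkEdge_inj _ _).2 (Or.inl ⟨rfl, Fin.ext h'⟩)⟩
    · exact ⟨⟨y, by omega⟩, (mkEdge_inj _ _).2 (Or.inr ⟨rfl, Fin.ext h'⟩)⟩
  refine ⟨RelIso.symm ⟨Equiv.ofBijective F ⟨hinj, hsurj⟩, ?_⟩⟩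
  intro i j
  change (pathGraph k).lineGraph.Adj (mkEdge (hadj i)) (mkEdge (hadj j)) ↔ _
  rw [lineGraph_adj_mkEdge, pathGraph_adj, ne_eq, mkEdge_inj]
  simp only [Fin.mk.injEq]
  omega

lemma hasFork_lineGraph_of_adj {v a b c a' : V} (ha : G.Adj v a) (hb : G.Adj v b)
    (hc : G.Adj v c) (hab : a ≠ b) (hac : a ≠ c) (hbc : b ≠ c) (ha' : G.Adj a a')
    (hne : a' ≠ v) : HasFork G.lineGraph := by
  have h1 := ha.ne
  have h2 := hb.ne
  have h3 := hc.ne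
  have h4 := ha'.ne
  refine ⟨mkEdge ha, mkEdge hb, mkEdge hc, mkEdge ha', ?_⟩
  simp only [lineGraph_adj_mkEdge, ne_eq, mkEdge_inj]
  grind

lemma hasFork_lineGraph_of_four {v a b c d : V} (ha : G.Adj v a) (hb : G.Adj v b)
    (hc : G.Adj v c) (hd : G.Adj v d) (hab : a ≠ b) (hac : a ≠ c) (hbc : b ≠ c)
    (hda : d ≠ a) (hdb : d ≠ b) (hdc : d ≠ c) : HasFork G.lineGraph := by
  have h1 := ha.ne
  have h2 := hb.ne
  have h3 := hc.ne
  have h4 := hd.ne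
  refine ⟨mkEdge ha, mkEdge hb, mkEdge hc, mkEdge hd, ?_⟩
  simp only [lineGraph_adj_mkEdge, ne_eq, mkEdge_inj]
  grind

lemma Preconnected.forall_of_adj (hG : G.Preconnected) {P : V → Prop}
    (hP : ∀ a b, G.Adj a b → P a → P b) {v : V} (hv : P v) (w : V) : P w := by
  obtain ⟨p⟩ := hG v w
  induction p with
  | nil => exact hv
  | cons h p ih => exact ih (hP _ _ h hv)

lemma nonempty_iso_claw (hG : G.Preconnected) {v a b c : V} (ha : G.Adj v a) (hb : G.Adj v b)
    (hc : G.Adj v c) (hab : a ≠ b) (hac : a ≠ c) (hbc : b ≠ c)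
    (hv : ∀ x, G.Adj v x → x = a ∨ x = b ∨ x = c) (ha' : ∀ x, G.Adj a x → x = v)
    (hb' : ∀ x, G.Adj b x → x = v) (hc' : ∀ x, G.Adj c x → x = v) :
    Nonempty (G ≃g completeBipartiteGraph (Fin 1) (Fin 3)) := by
  have hall : ∀ x, x = v ∨ x = a ∨ x = b ∨ x = c :=
    Preconnected.forall_of_adj hG (by grind) (Or.inl rfl)
  have h1 := ha.ne
  have h2 := hb.ne
  have h3 := hc.ne
  let F : Fin 1 ⊕ Fin 3 → V := Sum.elim (fun _ => v) ![a, b, c]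
  have hF : Function.Bijective F := by
    constructor
    · rintro (i | i) (j | j) h
      · rw [Subsingleton.elim i j]
      · fin_cases j <;> simp [F] at h <;> grind
      · fin_cases i <;> simp [F] at h <;> grind
      · fin_cases i <;> fin_cases j <;> simp [F] at h ⊢ <;> grind
    · intro x
      rcases hall x with rfl | rfl | rfl | rfl
      · exact ⟨Sum.inl 0, rfl⟩
      · exact ⟨Sum.inr 0, rfl⟩
      · exact ⟨Sum.inr 1, rfl⟩
      · exact ⟨Sum.inr 2, rfl⟩
  refine ⟨RelIso.symm ⟨Equiv.ofBijective F hF, ?_⟩⟩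
  have hadj : ∀ i, G.Adj v (![a, b, c] i) := by
    intro i; fin_cases i <;> assumption
  have hnadj : ∀ i x, G.Adj (![a, b, c] i) x → x = v := by
    intro i; fin_cases i <;> assumption
  rintro (i | i) (j | j)
  · simp [F]
  · simpa [F] using hadj j
  · simpa [F] using (hadj i).symm
  · simp only [completeBipartiteGraph_adj, Sum.isLeft_inr, Sum.isRight_inr, Bool.false_eq_true,
      and_true, and_false, or_self, iff_false]
    exact fun h => (hadj j).ne (hnadj i _ h).symm

/-- A connected graph with a vertex of degree at least three that is not the claw has a line graph
with a vertex of degree at least three. -/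
lemma HasFork.lineGraph (hG : G.Preconnected) (h : HasFork G)
    (hclaw : ¬ Nonempty (G ≃g completeBipartiteGraph (Fin 1) (Fin 3))) :
    HasFork G.lineGraph := by
  obtain ⟨v, a, b, c, ha, hb, hc, hab, hac, hbc⟩ := h
  by_contra hcon
  -- If the line graph has no fork, `v` has no fourth neighbour and `a`, `b`, `c` have no neighbour
  -- but `v`; connectedness then leaves only the claw.
  refine hclaw (nonempty_iso_claw hG ha hb hc hab hac hbc ?_ ?_ ?_ ?_)
  · intro d hd
    by_contra! h
    exact hcon (hasFork_lineGraph_of_four ha hb hc hd hab hac hbc h.1 h.2.1 h.2.2)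
  · intro x hx
    by_contra h
    exact hcon (hasFork_lineGraph_of_adj ha hb hc hab hac hbc hx h)
  · intro x hx
    by_contra h
    exact hcon (hasFork_lineGraph_of_adj hb ha hc hab.symm hbc hac hx h)
  · intro x hx
    by_contra h
    exact hcon (hasFork_lineGraph_of_adj hc hb ha hbc.symm hac.symm hab.symm hx h)

/-- Line graphs are claw-free. -/
lemma not_nonempty_lineGraph_iso_claw :
    ¬ Nonempty (G.lineGraph ≃g completeBipartiteGraph (Fin 1) (Fin 3)) := by
  rintro ⟨f⟩
  have hadj : ∀ i : Fin 3, G.lineGraph.Adj (f.symm (Sum.inl 0)) (f.symm (Sum.inr i)) := by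
    intro i
    rw [f.symm.map_adj_iff]
    simp
  have hnadj : ∀ i j : Fin 3, ¬ G.lineGraph.Adj (f.symm (Sum.inr i)) (f.symm (Sum.inr j)) := by
    intro i j
    rw [f.symm.map_adj_iff]
    simp
  have hne : ∀ i j : Fin 3, i ≠ j → f.symm (Sum.inr i) ≠ f.symm (Sum.inr j) := by
    intro i j h h'
    exact h (Sum.inr_injective (f.symm.injective h'))
  have h0 := hadj 0
  have h1 := hadj 1
  have h2 := hadj 2
  have h3 := hnadj 0 1
  have h4 := hnadj 0 2
  have h5 := hnadj 1 2
  have h6 := hne 0 1 (by decide)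
  have h7 := hne 0 2 (by decide)
  have h8 := hne 1 2 (by decide)
  -- Pigeonhole: each leaf is an edge through `u` or `v`, so two of the three leaves meet.
  obtain ⟨u, v, h, he⟩ := exists_eq_mkEdge (f.symm (Sum.inl 0))
  obtain ⟨u₀, v₀, k₀, he₀⟩ := exists_eq_mkEdge (f.symm (Sum.inr 0))
  obtain ⟨u₁, v₁, k₁, he₁⟩ := exists_eq_mkEdge (f.symm (Sum.inr 1))
  obtain ⟨u₂, v₂, k₂, he₂⟩ := exists_eq_mkEdge (f.symm (Sum.inr 2))
  rw [he, he₀, lineGraph_adj_mkEdge] at h0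
  rw [he, he₁, lineGraph_adj_mkEdge] at h1
  rw [he, he₂, lineGraph_adj_mkEdge] at h2
  rw [he₀, he₁] at h3 h6
  rw [he₀, he₂] at h4 h7
  rw [he₁, he₂] at h5 h8
  rw [lineGraph_adj_mkEdge] at h3 h4 h5
  have h0 := h0.2
  have h1 := h1.2
  have h2 := h2.2
  have h3 := fun h => h3 ⟨h6, h⟩
  have h4 := fun h => h4 ⟨h7, h⟩
  have h5 := fun h => h5 ⟨h8, h⟩
  clear h6 h7 h8
  grind

/-! ### Connected graphs of maximum degree at most two -/

/-- A connected graph of maximum degree at most two is a path or a cycle. -/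
lemma path_or_cycle_of_not_hasFork [Finite V] (hG : G.Connected) (h : ¬ HasFork G) :
    (∃ k, 1 ≤ k ∧ Nonempty (G ≃g pathGraph k)) ∨ ∃ k, 3 ≤ k ∧ Nonempty (G ≃g cycleGraph k) := by
  classical
  have := Fintype.ofFinite V
  obtain ⟨v₀⟩ := hG.nonempty
  have hdeg : ∀ v a b c, G.Adj v a → G.Adj v b → G.Adj v c → a = b ∨ a = c ∨ b = c := by
    intro v a b c ha hb hc
    by_contra! hne
    exact h ⟨v, a, b, c, ha, hb, hc, hne.1, hne.2.1, hne.2.2⟩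
  -- Take a longest path `l`.
  let P : ℕ → Prop := fun n => ∃ l : List V, l.length = n ∧ l.Nodup ∧ l.IsChain G.Adj
  have hbound : ∀ n, P n → n ≤ Fintype.card V := by
    rintro n ⟨l, rfl, hl, -⟩
    exact hl.length_le_card
  have hP1 : P 1 := ⟨[v₀], rfl, by simp, by simp⟩
  obtain ⟨l, hln, hnd, hch⟩ : P (Nat.findGreatest P (Fintype.card V)) :=
    Nat.findGreatest_spec (hbound 1 hP1) hP1
  have hmax : ∀ l' : List V, l'.Nodup → l'.IsChain G.Adj → l'.length ≤ l.length := by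
    intro l' h1 h2
    rw [hln]
    exact Nat.le_findGreatest (hbound _ ⟨l', rfl, h1, h2⟩) ⟨l', rfl, h1, h2⟩
  have hpos : 1 ≤ l.length := hmax [v₀] (by simp) (by simp)
  have hadj : ∀ i (hi : i + 1 < l.length), G.Adj l[i] l[i + 1] := by
    intro i hi
    exact List.isChain_iff_getElem.1 hch i hi
  have hinj : ∀ i j (hi : i < l.length) (hj : j < l.length), l[i] = l[j] → i = j :=
    fun i j hi hj hij => (hnd.getElem_inj_iff).1 hij
  -- A neighbour outside `l` would lengthen the path if attached to an end, and be a third neighbour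
  -- if attached to an interior vertex. By connectedness `l` covers the graph.
  have hclosed : ∀ a b, G.Adj a b → a ∈ l → b ∈ l := by
    intro a b hab ha
    by_contra hb
    obtain ⟨i, hi, rfl⟩ := List.getElem_of_mem ha
    by_cases h0 : i = 0
    · subst h0
      have := hmax (b :: l) (List.nodup_cons.2 ⟨hb, hnd⟩) (by
        rw [List.isChain_cons]
        refine ⟨fun y hy => ?_, hch⟩
        rw [List.head?_eq_getElem?, List.getElem?_eq_getElem hi] at hy
        simp only [Option.mem_def, Option.some.injEq] at hy
        exact hy ▸ hab.symm)
      simp at this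
    by_cases h1 : i + 1 = l.length
    · have := hmax (l ++ [b]) (by
        rw [List.nodup_append]
        refine ⟨hnd, by simp, ?_⟩
        rintro x hx y hy rfl
        exact hb (by simpa using List.mem_singleton.1 hy ▸ hx)) (by
        rw [List.isChain_append]
        refine ⟨hch, by simp, fun x hx y hy => ?_⟩
        rw [List.getLast?_eq_getElem?, List.getElem?_eq_getElem (by omega)] at hx
        simp only [Option.mem_def, Option.some.injEq, List.head?_cons] at hx hy
        subst hx hy
        simpa [← h1] using hab)
      simp at this
    · have h2 := hadj i (by omega)
      have h3 := hadj (i - 1) (by omega)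
      simp only [Nat.sub_add_cancel (Nat.one_le_iff_ne_zero.2 h0)] at h3
      rcases hdeg _ _ _ _ h2 h3.symm hab with h | h | h
      · have := hinj _ _ _ _ h; omega
      · exact hb (h ▸ List.getElem_mem _)
      · exact hb (h ▸ List.getElem_mem _)
  have hall : ∀ x, x ∈ l :=
    Preconnected.forall_of_adj hG.preconnected hclosed (List.getElem_mem hpos)
  -- Any other edge would give an interior vertex of the path a third neighbour, so only the two
  -- ends can be joined by a chord.
  have hchord : ∀ i j (hi : i < l.length) (hj : j < l.length), i < j → G.Adj l[i] l[j] →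
      j = i + 1 ∨ (i = 0 ∧ j + 1 = l.length) := by
    intro i j hi hj hij ha
    by_cases h0 : i = 0
    · by_cases h1 : j + 1 = l.length
      · exact Or.inr ⟨h0, h1⟩
      · have h2 := hadj j (by omega)
        have h3 := hadj (j - 1) (by omega)
        simp only [Nat.sub_add_cancel (show 1 ≤ j by omega)] at h3
        rcases hdeg _ _ _ _ h2 h3.symm ha.symm with h | h | h <;>
          have := hinj _ _ _ _ h <;> omega
    · have h2 := hadj i (by omega)
      have h3 := hadj (i - 1) (by omega)
      simp only [Nat.sub_add_cancel (show 1 ≤ i by omega)] at h3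
      rcases hdeg _ _ _ _ h2 h3.symm ha with h | h | h <;>
        have := hinj _ _ _ _ h <;> omega
  let E : Fin l.length ≃ V := hnd.getEquivOfForallMemList l hall
  have hE : ∀ i : Fin l.length, E i = l[i.1] := fun i => rfl
  have hadjE : ∀ i j : Fin l.length, G.Adj (E i) (E j) ↔
      (i.1 + 1 = j.1 ∨ j.1 + 1 = i.1) ∨ (G.Adj (E i) (E j) ∧
        ((i.1 = 0 ∧ j.1 + 1 = l.length) ∨ (j.1 = 0 ∧ i.1 + 1 = l.length))) := by
    intro i j
    rw [hE, hE]
    constructor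
    · intro ha
      rcases lt_trichotomy i.1 j.1 with hij | hij | hij
      · rcases hchord _ _ i.2 j.2 hij ha with h | h
        · exact Or.inl (Or.inl h.symm)
        · exact Or.inr ⟨ha, Or.inl h⟩
      · exact absurd ha (by rw [Fin.ext hij]; exact G.irrefl)
      · rcases hchord _ _ j.2 i.2 hij ha.symm with h | h
        · exact Or.inl (Or.inr h.symm)
        · exact Or.inr ⟨ha, Or.inr h⟩
    · rintro ((h | h) | h)
      · have := hadj i.1 (by omega)
        simpa only [h] using this
      · have := (hadj j.1 (by omega)).symm
        simpa only [h] using this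
      · exact h.1
  -- On two vertices the ends are already joined by the path's own edge, hence the bound 3.
  by_cases hcyc : 3 ≤ l.length ∧ G.Adj l[0] l[l.length - 1]
  · refine Or.inr ⟨l.length, hcyc.1, ⟨RelIso.symm ⟨E, ?_⟩⟩⟩
    have hsub : ∀ i j : Fin l.length, (i - j).1 = 1 ↔
        j.1 + 1 = i.1 ∨ (i.1 = 0 ∧ j.1 + 1 = l.length) := by
      intro i j
      rcases le_or_gt j i with hij | hij
      · rw [Fin.sub_val_of_le hij]
        have := Fin.le_def.1 hij
        omega
      · rw [Fin.coe_sub_iff_lt.2 hij]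
        have := Fin.lt_def.1 hij
        omega
    intro i j
    rw [cycleGraph_adj', hsub, hsub, hadjE]
    refine ⟨by tauto, ?_⟩
    rintro ((h | ⟨h, h'⟩) | (h | ⟨h, h'⟩))
    · exact Or.inl (Or.inr h)
    · refine Or.inr ⟨?_, Or.inl ⟨h, h'⟩⟩
      rw [hE, hE]
      simpa only [h, show j.1 = l.length - 1 by omega] using hcyc.2
    · exact Or.inl (Or.inl h)
    · refine Or.inr ⟨?_, Or.inr ⟨h, h'⟩⟩
      rw [hE, hE]
      simpa only [h, show i.1 = l.length - 1 by omega] using hcyc.2.symm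
  · refine Or.inl ⟨l.length, hpos, ⟨RelIso.symm ⟨E, ?_⟩⟩⟩
    have hends : ∀ i j : Fin l.length, G.Adj (E i) (E j) → i.1 = 0 → j.1 + 1 = l.length →
        i.1 + 1 = j.1 := by
      intro i j ha hi hj
      by_contra hne
      have hij : i.1 ≠ j.1 := fun h => by
        rw [Fin.ext h] at ha
        exact G.irrefl ha
      refine hcyc ⟨by omega, ?_⟩
      rw [hE, hE] at ha
      simpa only [hi, show j.1 = l.length - 1 by omega] using ha
    intro i j
    rw [pathGraph_adj, hadjE]
    refine ⟨?_, Or.inl⟩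
    rintro (h | ⟨h, h' | h'⟩)
    · exact h
    · exact Or.inl (hends i j h h'.1 h'.2)
    · exact Or.inr (hends j i h.symm h'.1 h'.2)

end LineGraph

/-! ### Edge counts of line graphs -/

section Count

variable {V : Type u} (G : SimpleGraph V) [Fintype V] [DecidableRel G.Adj]

/-- An angle is a vertex with an ordered pair of distinct neighbours. -/
def angleEquivSigma [DecidableEq V] : Angle G ≃ Σ v, (G.neighborFinset v).offDiag where
  toFun t := ⟨t.v, (t.u, t.w), by
    simpa [Finset.mem_offDiag] using ⟨t.adj_left, t.adj_right, t.ne⟩⟩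
  invFun p := ⟨p.2.1.1, p.1, p.2.1.2, by
    simpa using (Finset.mem_offDiag.1 p.2.2).1, by
    simpa using (Finset.mem_offDiag.1 p.2.2).2.1, (Finset.mem_offDiag.1 p.2.2).2.2⟩
  left_inv _ := rfl
  right_inv _ := rfl

lemma two_mul_card_edgeSet : 2 * Nat.card G.edgeSet = ∑ v, G.degree v := by
  rw [sum_degrees_eq_twice_card_edges, edgeFinset_card, Nat.card_eq_fintype_card]

lemma card_dart_eq {V : Type u} (G : SimpleGraph V) [Finite V] :
    Nat.card G.Dart = 2 * Nat.card G.edgeSet := by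
  classical
  have := Fintype.ofFinite V
  rw [two_mul_card_edgeSet, Nat.card_eq_fintype_card, dart_card_eq_sum_degrees]

/-- Both sides count the angles of `G`. -/
lemma two_mul_card_edgeSet_lineGraph :
    2 * Nat.card G.lineGraph.edgeSet = ∑ v, G.degree v * (G.degree v - 1) := by
  classical
  rw [← card_dart_eq, ← Nat.card_congr (angleEquivDart G), Nat.card_congr (angleEquivSigma G),
    Nat.card_sigma]
  refine Finset.sum_congr rfl fun v _ => ?_
  rw [Nat.card_eq_fintype_card, Fintype.card_coe, Finset.offDiag_card, card_neighborFinset_eq_degree,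
    Nat.mul_sub_one]

end Count

section Finite

variable {V : Type u} {G : SimpleGraph V} [Finite V]

/-- This is `(d - 1)(d - 2) ≥ 0`. -/
lemma two_mul_le_mul_pred_add_two (d : ℕ) : 2 * d ≤ d * (d - 1) + 2 := by
  rcases d with _ | _ | d
  · simp
  · simp
  · simp only [Nat.add_sub_cancel]
    nlinarith [Nat.zero_le (d * d)]

/-- Strict convexity of the orders of `G`, `L(G)`, `L²(G)`: summing `(d - 1)(d - 2) ≥ 0` over the
vertices, the fork gives a strict term. -/
lemma HasFork.two_mul_card_edgeSet_lt (h : HasFork G) :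
    2 * Nat.card G.edgeSet < Nat.card G.lineGraph.edgeSet + Nat.card V := by
  classical
  have := Fintype.ofFinite V
  have h1 := two_mul_card_edgeSet G
  have h2 := two_mul_card_edgeSet_lineGraph G
  obtain ⟨v, a, b, c, ha, hb, hc, hab, hac, hbc⟩ := h
  have hdeg : 3 ≤ G.degree v := by
    rw [← card_neighborFinset_eq_degree, ← Finset.card_eq_three.2 ⟨a, b, c, hab, hac, hbc, rfl⟩]
    refine Finset.card_le_card fun x hx => ?_
    simp only [Finset.mem_insert, Finset.mem_singleton] at hx
    rw [mem_neighborFinset]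
    rcases hx with rfl | rfl | rfl <;> assumption
  have h3 : ∑ v, 2 * G.degree v < ∑ v, (G.degree v * (G.degree v - 1) + 2) := by
    refine Finset.sum_lt_sum (fun v _ => two_mul_le_mul_pred_add_two _) ⟨v, Finset.mem_univ _, ?_⟩
    have : G.degree v * 2 ≤ G.degree v * (G.degree v - 1) := Nat.mul_le_mul_left _ (by omega)
    omega
  rw [← Finset.mul_sum, Finset.sum_add_distrib, Finset.sum_const, Finset.card_univ,
    ← Nat.card_eq_fintype_card, smul_eq_mul] at h3
  omega

lemma TwoRegular.card_edgeSet (h : TwoRegular G) : Nat.card G.edgeSet = Nat.card V := by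
  classical
  have := Fintype.ofFinite V
  have h1 := two_mul_card_edgeSet G
  have hdeg : ∀ v, G.degree v = 2 := by
    intro v
    obtain ⟨a, b, hab, hv⟩ := h v
    rw [← card_neighborFinset_eq_degree, Finset.card_eq_two]
    exact ⟨a, b, hab, by ext x; simp [hv]⟩
  simp only [hdeg, Finset.sum_const, Finset.card_univ, smul_eq_mul] at h1
  rw [Nat.card_eq_fintype_card (α := V)]
  omega

end Finite

/-! ### Absence of isolated edges -/

lemma noIsolatedEdge_of_twoRegular {V : Type*} {G : SimpleGraph V} (h : TwoRegular G) : NoIsolatedEdge G := by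
  intro u v huv
  obtain ⟨a, b, hab, hu⟩ := h u
  refine Or.inl ?_
  rcases (hu v).1 huv with rfl | rfl
  · exact ⟨b, hab.symm, (hu b).2 (Or.inr rfl)⟩
  · exact ⟨a, hab, (hu a).2 (Or.inl rfl)⟩

/-- By connectedness an isolated edge would be the whole graph, which has too few vertices for a
fork. -/
lemma noIsolatedEdge_of_hasFork {V : Type*} {G : SimpleGraph V} (hG : G.Preconnected) (h : HasFork G) : NoIsolatedEdge G := by
  intro u v huv
  by_contra! hcon
  obtain ⟨x, a, b, c, -, -, -, hab, hac, hbc⟩ := h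
  have hall : ∀ y, y = u ∨ y = v :=
    Preconnected.forall_of_adj hG (by
      rintro y z hyz (rfl | rfl)
      · by_contra h
        exact hcon.1 z (fun h' => h (Or.inr h')) hyz
      · by_contra h
        exact hcon.2 z (fun h' => h (Or.inl h')) hyz) (Or.inl rfl)
  have := hall a
  have := hall b
  have := hall c
  grind

lemma noIsolatedEdge_pathGraph {k : ℕ} (hk : 3 ≤ k) : NoIsolatedEdge (pathGraph k) := by
  have key : ∀ u v : Fin k, u.1 + 1 = v.1 →
      (∃ w, w ≠ v ∧ (pathGraph k).Adj u w) ∨ ∃ w, w ≠ u ∧ (pathGraph k).Adj v w := by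
    intro u v huv
    by_cases hu : u.1 = 0
    · refine Or.inr ⟨⟨v + 1, by omega⟩, ?_, ?_⟩
      · rw [ne_eq, Fin.ext_iff]
        dsimp only
        omega
      · rw [pathGraph_adj]
        exact Or.inl rfl
    · refine Or.inl ⟨⟨u - 1, by omega⟩, ?_, ?_⟩
      · rw [ne_eq, Fin.ext_iff]
        dsimp only
        omega
      · rw [pathGraph_adj]
        dsimp only
        omega
  intro u v huv
  rw [pathGraph_adj] at huv
  rcases huv with h | h
  · exact key u v h
  · exact (key v u h).symm

lemma NoIsolatedEdge.of_iso {V : Type*} {W : Type*} {G : SimpleGraph V} {H : SimpleGraph W}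
    (f : G ≃g H) (h : NoIsolatedEdge H) : NoIsolatedEdge G := by
  intro u v huv
  rcases h _ _ (f.map_adj_iff.2 huv) with ⟨w, hw, hadj⟩ | ⟨w, hw, hadj⟩
  · refine Or.inl ⟨f.symm w, fun h' => hw (by rw [← h', f.apply_symm_apply]), ?_⟩
    rw [← f.map_adj_iff, f.apply_symm_apply]
    exact hadj
  · refine Or.inr ⟨f.symm w, fun h' => hw (by rw [← h', f.apply_symm_apply]), ?_⟩
    rw [← f.map_adj_iff, f.apply_symm_apply]
    exact hadj

/-! ### Iteration and growth -/

lemma Iso.card_eq {G H : FinGraph.{u}} (h : Iso G H) : Nat.card G.V = Nat.card H.V :=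
  Nat.card_congr h.some.toEquiv

lemma card_burgeon (G : FinGraph.{u}) : Nat.card G.burgeon.V = 2 * Nat.card G.lineGraph.V :=
  card_dart_eq G.graph

lemma iterate_edgeBicliqueGraph_burgeon_iso (G : FinGraph.{u}) (n : ℕ)
    (h : ∀ i < n, NoIsolatedEdge (lineGraph^[i] G).graph) :
    Iso (edgeBicliqueGraph^[n] G.burgeon) (lineGraph^[n] G).burgeon := by
  induction n with
  | zero => exact Iso.refl _
  | succ n ih =>
    rw [Function.iterate_succ_apply', Function.iterate_succ_apply']
    exact (ih fun i hi => h i (by omega)).edgeBicliqueGraph.trans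
      (edgeBicliqueGraph_burgeon_iso _ (h n (by omega)))

lemma iterate_induction {P : FinGraph.{u} → Prop} (hP : ∀ G, P G → P (lineGraph G))
    {G : FinGraph.{u}} (hG : P G) (n : ℕ) : P (lineGraph^[n] G) := by
  induction n with
  | zero => exact hG
  | succ n ih =>
    rw [Function.iterate_succ_apply']
    exact hP _ ih

/-- The disjunction in `h` is invariant under `L`; the claw passes from the second alternative to
the first, its line graph being a triangle. -/
lemma noIsolatedEdge_iterate {G : FinGraph.{u}}
    (h : TwoRegular G.graph ∨ G.graph.Preconnected ∧ HasFork G.graph) (n : ℕ) :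
    NoIsolatedEdge (lineGraph^[n] G).graph := by
  have := iterate_induction
    (P := fun G => TwoRegular G.graph ∨ G.graph.Preconnected ∧ HasFork G.graph) (by
      rintro G (h | ⟨h, h'⟩)
      · exact Or.inl h.lineGraph
      · by_cases hclaw : Nonempty (G.graph ≃g completeBipartiteGraph (Fin 1) (Fin 3))
        · exact Or.inl (twoRegular_lineGraph_claw.of_iso hclaw.some.symm.lineGraph)
        · exact Or.inr ⟨lineGraph_preconnected h, h'.lineGraph h hclaw⟩) h n
  rcases this with h | ⟨h, h'⟩
  · exact noIsolatedEdge_of_twoRegular h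
  · exact noIsolatedEdge_of_hasFork h h'

lemma card_iterate_of_twoRegular {G : FinGraph.{u}} (h : TwoRegular G.graph) (n : ℕ) :
    Nat.card (lineGraph^[n] G).V = Nat.card G.V := by
  induction n with
  | zero => rfl
  | succ n ih =>
    rw [Function.iterate_succ_apply', ← ih]
    exact (iterate_induction (P := fun G => TwoRegular G.graph) (fun _ h => h.lineGraph) h
      n).card_edgeSet

/-- The iterated line graphs of a connected graph that is not a path, a cycle or the claw have
unbounded order. -/
lemma tendsto_card_iterate_lineGraph {G : FinGraph.{u}} (hG : G.graph.Connected)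
    (h : HasFork G.graph) (hclaw : ¬ G.IsClaw) :
    Tendsto (fun n => Nat.card (lineGraph^[n] G).V) atTop atTop := by
  set x : ℕ → ℕ := fun n => Nat.card (lineGraph^[n] G).V with hx
  have hconv : ∀ n, 2 * x (n + 1) < x (n + 2) + x n := by
    intro n
    have := iterate_induction
      (P := fun G => G.graph.Preconnected ∧ HasFork G.graph ∧ ¬ G.IsClaw)
      (fun _ h => ⟨lineGraph_preconnected h.1, h.2.1.lineGraph h.1 h.2.2,
        not_nonempty_lineGraph_iso_claw⟩) ⟨hG.preconnected, h, hclaw⟩ n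
    simp only [hx, Function.iterate_succ_apply']
    exact this.2.1.two_mul_card_edgeSet_lt
  have h0 : x 0 ≤ x 1 + 1 := hG.card_vert_le_card_edgeSet_add_one
  -- The differences of `x` start at `-1` or more and increase strictly, so they are positive from
  -- `x 3 - x 2` on.
  have hstep : ∀ n, x (n + 2) + 1 ≤ x (n + 3) := by
    intro n
    induction n with
    | zero =>
      have := hconv 0
      have := hconv 1
      simp only [Nat.zero_add, Nat.reduceAdd] at *
      omega
    | succ n ih =>
      have := hconv (n + 2)
      simp only [Nat.add_assoc, Nat.reduceAdd] at *
      omega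
  refine (tendsto_add_atTop_iff_nat 2).1 (strictMono_nat_of_lt_succ fun n => ?_).tendsto_atTop
  exact hstep n

/-! ### The path case -/

lemma nonempty_iterate_lineGraph_pathGraph_iso {G : FinGraph.{u}} {k : ℕ}
    (h : Nonempty (G.graph ≃g pathGraph k)) (n : ℕ) :
    Nonempty ((lineGraph^[n] G).graph ≃g pathGraph (k - n)) := by
  induction n with
  | zero => exact h
  | succ n ih =>
    rw [Function.iterate_succ_apply']
    obtain ⟨f⟩ := ih
    obtain ⟨g⟩ := nonempty_lineGraph_pathGraph_iso (k - n)
    exact ⟨f.lineGraph.trans g⟩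

lemma isEmpty_edgeBicliqueGraph_of_subsingleton {G : FinGraph.{u}} [Subsingleton G.V] :
    IsEmpty (edgeBicliqueGraph G).V := by
  refine ⟨fun S => ?_⟩
  obtain ⟨U, W, ⟨a, ha⟩, ⟨b, hb⟩, hdisj, -⟩ := S.2.prop
  exact Set.disjoint_left.1 hdisj ha (Subsingleton.elim b a ▸ hb)

lemma isEmpty_iterate_edgeBicliqueGraph {G : FinGraph.{u}} [h : IsEmpty G.V] (n : ℕ) :
    IsEmpty (edgeBicliqueGraph^[n] G).V := by
  induction n with
  | zero => exact h
  | succ n ih =>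
    rw [Function.iterate_succ_apply']
    exact isEmpty_edgeBicliqueGraph_of_subsingleton

/-- Here the one-step isomorphism fails: the burgeon graph has just two vertices, so a biclique must
be all of it. -/
lemma subsingleton_edgeBicliqueGraph_burgeon {G : FinGraph.{u}}
    (h : Nonempty (G.graph ≃g pathGraph 2)) : Subsingleton (edgeBicliqueGraph G.burgeon).V := by
  obtain ⟨f⟩ := h
  have hall : ∀ d e : G.graph.Dart, d ≠ e → ∀ x, x = d ∨ x = e := by
    have key : ∀ d : G.graph.Dart, (f d.fst = 0 ∧ f d.snd = 1) ∨ (f d.fst = 1 ∧ f d.snd = 0) := by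
      intro d
      have := f.map_adj_iff.2 d.adj
      rw [pathGraph_adj] at this
      simp only [Fin.ext_iff]
      simp
      omega
    intro d e hne x
    have hd := key d
    have he := key e
    have hx := key x
    simp only [ne_eq, Dart.ext_iff, Prod.ext_iff, ← f.injective.eq_iff] at *
    grind
  refine ⟨fun S T => Subtype.ext ?_⟩
  have huniv : ∀ S : (edgeBicliqueGraph G.burgeon).V, S.1 = Set.univ := by
    intro S
    obtain ⟨U, W, ⟨a, ha⟩, ⟨b, hb⟩, hdisj, hS, -⟩ := S.2.prop
    refine Set.eq_univ_of_forall fun x => ?_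
    rw [← hS]
    rcases hall a b (fun h => Set.disjoint_left.1 hdisj ha (h ▸ hb)) x with rfl | rfl
    · exact Or.inl ha
    · exact Or.inr hb
  rw [huniv S, huniv T]

lemma isEmpty_burgeon_of_subsingleton {G : FinGraph.{u}} [Subsingleton G.V] :
    IsEmpty G.burgeon.V :=
  ⟨fun d : G.graph.Dart => d.fst_ne_snd (Subsingleton.elim _ _)⟩

lemma noIsolatedEdge_iterate_of_path {G : FinGraph.{u}} {k : ℕ}
    (h : Nonempty (G.graph ≃g pathGraph k)) {i : ℕ} (hi : i + 3 ≤ k) :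
    NoIsolatedEdge (lineGraph^[i] G).graph :=
  (noIsolatedEdge_pathGraph (by omega)).of_iso
    (nonempty_iterate_lineGraph_pathGraph_iso h i).some

/-- For `k ≥ 2`, after `k - 2` steps one reaches the burgeon graph of the path on two vertices; one
more step leaves at most one vertex, and the next leaves none. -/
lemma isEmpty_iterate_of_path {G : FinGraph.{u}} {k : ℕ} (hk : 1 ≤ k)
    (h : Nonempty (G.graph ≃g pathGraph k)) {n : ℕ} (hn : k ≤ n) :
    IsEmpty (edgeBicliqueGraph^[n] G.burgeon).V := by
  obtain ⟨m, rfl⟩ := Nat.exists_eq_add_of_le' hn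
  rw [Function.iterate_add_apply]
  suffices IsEmpty (edgeBicliqueGraph^[k] G.burgeon).V from isEmpty_iterate_edgeBicliqueGraph m
  rcases hk.eq_or_lt with rfl | hk
  · have : Subsingleton G.V := h.some.toEquiv.subsingleton
    have := isEmpty_burgeon_of_subsingleton (G := G)
    exact isEmpty_iterate_edgeBicliqueGraph 1
  · obtain ⟨j, rfl⟩ := Nat.exists_eq_add_of_le' hk
    have h1 := (iterate_edgeBicliqueGraph_burgeon_iso G j fun i hi =>
      noIsolatedEdge_iterate_of_path h (by omega)).edgeBicliqueGraph
    have h2 := nonempty_iterate_lineGraph_pathGraph_iso h j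
    rw [show j + (1 + 1) - j = 2 by omega] at h2
    have := subsingleton_edgeBicliqueGraph_burgeon h2
    have h3 := h1.some.toEquiv.subsingleton
    rw [show j + (1 + 1) = j + 1 + 1 by omega, Function.iterate_succ_apply',
      Function.iterate_succ_apply']
    exact isEmpty_edgeBicliqueGraph_of_subsingleton

lemma isEmpty_burgeon_iterate_of_path {G : FinGraph.{u}} {k : ℕ}
    (h : Nonempty (G.graph ≃g pathGraph k)) {n : ℕ} (hn : k ≤ n) :
    IsEmpty (lineGraph^[n] G).burgeon.V := by
  have h2 := nonempty_iterate_lineGraph_pathGraph_iso h n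
  rw [Nat.sub_eq_zero_of_le hn] at h2
  have : Subsingleton (lineGraph^[n] G).V := h2.some.toEquiv.subsingleton
  exact isEmpty_burgeon_of_subsingleton

lemma Iso.of_isEmpty {G H : FinGraph.{u}} [IsEmpty G.V] [IsEmpty H.V] : Iso G H :=
  ⟨⟨Equiv.equivOfIsEmpty _ _, fun {a} => isEmptyElim a⟩⟩

lemma twoRegular_or_hasFork_of_not_isPath {G : FinGraph.{u}} (hG : G.graph.Connected)
    (h : ¬ G.IsPath) : TwoRegular G.graph ∨ G.graph.Preconnected ∧ HasFork G.graph := by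
  by_cases hf : HasFork G.graph
  · exact Or.inr ⟨hG.preconnected, hf⟩
  · rcases path_or_cycle_of_not_hasFork hG hf with hp | ⟨k, hk, ⟨f⟩⟩
    · exact absurd hp h
    · exact Or.inl ((twoRegular_cycleGraph hk).of_iso f.symm)

lemma not_diverges_of_eventually_eq {H : FinGraph.{u} → FinGraph.{u}} {G : FinGraph.{u}} {m : ℕ}
    (h : ∀ n, m ≤ n → Nat.card (H^[n] G).V = Nat.card (H^[m] G).V) : ¬ Diverges H G := by
  intro hd
  obtain ⟨n, hn, hn'⟩ :=
    ((eventually_ge_atTop m).and (hd.eventually_gt_atTop (Nat.card (H^[m] G).V))).exists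
  rw [h n hn] at hn'
  exact lt_irrefl _ hn'

end FinGraph

theorem mainTheorem4 (G : FinGraph.{u}) (hG : G.graph.Connected) :
    (FinGraph.Diverges FinGraph.edgeBicliqueGraph G.burgeon ↔
      ¬ (G.IsCycle ∨ G.IsPath ∨ G.IsClaw)) ∧
    ∀ n : ℕ, (n = 0 ∨ ¬ Nonempty (G.graph ≃g SimpleGraph.pathGraph (n + 1))) →
      FinGraph.Iso (FinGraph.edgeBicliqueGraph^[n] G.burgeon)
        (FinGraph.lineGraph^[n] G).burgeon := by
  by_cases hpath : G.IsPath
  · obtain ⟨k, hk, h⟩ := hpath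
    have hempty := fun n (hn : k ≤ n) => FinGraph.isEmpty_iterate_of_path hk h hn
    refine ⟨iff_of_false (FinGraph.not_diverges_of_eventually_eq (m := k) fun n hn => ?_)
      (fun hcon => hcon (Or.inr (Or.inl ⟨k, hk, h⟩))), fun n hn => ?_⟩
    · have := hempty n hn
      have := hempty k le_rfl
      rw [Nat.card_of_isEmpty, Nat.card_of_isEmpty]
    · rcases le_or_gt k n with hkn | hkn
      · have := hempty n hkn
        have := FinGraph.isEmpty_burgeon_iterate_of_path h hkn
        exact FinGraph.Iso.of_isEmpty
      · refine FinGraph.iterate_edgeBicliqueGraph_burgeon_iso G n fun i hi =>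
          FinGraph.noIsolatedEdge_iterate_of_path h ?_
        rcases hn with rfl | hn
        · omega
        -- With `n < k` this gives `n + 2 ≤ k`, so every `L^i(G)` with `i < n` is a path on at least
        -- three vertices.
        · have : k ≠ n + 1 := by
            rintro rfl
            exact hn h
          omega
  · have hQ := FinGraph.twoRegular_or_hasFork_of_not_isPath hG hpath
    have hiso : ∀ n, FinGraph.Iso (FinGraph.edgeBicliqueGraph^[n] G.burgeon)
        (FinGraph.lineGraph^[n] G).burgeon := fun n =>
      FinGraph.iterate_edgeBicliqueGraph_burgeon_iso G n fun i _ =>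
        FinGraph.noIsolatedEdge_iterate hQ i
    -- This reduces divergence under `KB_e` to divergence under `L`, shifted by one step.
    have hcard : ∀ n, Nat.card (FinGraph.edgeBicliqueGraph^[n] G.burgeon).V =
        2 * Nat.card (FinGraph.lineGraph^[n + 1] G).V := by
      intro n
      rw [(hiso n).card_eq, FinGraph.card_burgeon, Function.iterate_succ_apply']
    refine ⟨⟨?_, fun h => ?_⟩, fun n _ => hiso n⟩
    · rintro hd (⟨k, hk, ⟨f⟩⟩ | h | ⟨⟨f⟩⟩)
      · have h2 := (FinGraph.twoRegular_cycleGraph hk).of_iso f.symm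
        refine FinGraph.not_diverges_of_eventually_eq (m := 0) (fun n _ => ?_) hd
        rw [hcard, hcard, FinGraph.card_iterate_of_twoRegular h2,
          FinGraph.card_iterate_of_twoRegular h2]
      · exact hpath h
      · have h2 : FinGraph.TwoRegular (FinGraph.lineGraph G).graph :=
          FinGraph.twoRegular_lineGraph_claw.of_iso f.symm.lineGraph
        refine FinGraph.not_diverges_of_eventually_eq (m := 0) (fun n _ => ?_) hd
        rw [hcard, hcard, Function.iterate_succ_apply, Function.iterate_succ_apply,
          FinGraph.card_iterate_of_twoRegular h2, FinGraph.card_iterate_of_twoRegular h2]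
    · have hfork : FinGraph.HasFork G.graph := by
        by_contra hf
        rcases FinGraph.path_or_cycle_of_not_hasFork hG hf with hp | hc
        · exact hpath hp
        · exact h (Or.inl hc)
      have ht := FinGraph.tendsto_card_iterate_lineGraph hG hfork fun hc => h (Or.inr (Or.inr hc))
      have ht' := (tendsto_add_atTop_iff_nat 1).2 ht
      refine tendsto_atTop_mono (fun n => ?_) ht'
      rw [hcard]
      omega
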